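/- Let $\mathbf z=(z_1,\dots,z_n)$ be a real random vector on a probability space. Call $\mathbf z$ pairwise mean independent if, for all $i\neq j$, $z_i$ is integrable and $\mathbb E(z_i\mid z_j)=\mathbb E(z_i)$ almost surely. For $d\ge 2$ let $S^d(\mathbb R^n)$ be the space of real symmetric $n\times\cdots\times n$ tensors of order $d$, and let $$V^{d,n}_{\mathrm{pmi}}=\{T\in S^d(\mathbb R^n)\;:\;T_{ij\cdots j}=0\text{ for all } i\neq j\}.$$ Let $K_{\mathbf z}(t)=\log \mathbb E(e^{t^\top \mathbf z})$, $t\in\mathbb R^n$, be the cumulant generating function. The $d$-th cumulant tensor $\kappa_d(\mathbf z)$ has entries $$\kappa_d(\mathbf z)_{i_1,\dots,i_d}=\frac{\partial^d}{\partial t_{i_1}\cdots\partial t_{i_d}}K_{\mathbf z}(t)\Big|_{t=0}$$ when $K_{\mathbf z}$ is finite in a neighbourhood of $0$, and, whenever all moments $\mathbb E(z_{i_1}\cdots z_{i_d})$ of order $d$ exist, $$\kappa_d(\mathbf z)_{i_1,\dots,i_d}=\sum_{\pi}(-1)^{|\pi|-1}(|\pi|-1)!\prod_{B\in\pi}\mathbb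 E\Big(\prod_{k\in B}z_{i_k}\Big),$$ where $\pi$ runs over the set partitions of $\{1,\dots,d\}$ and $|\pi|$ is the number of blocks of $\pi$. With either description of $\kappa_d(\mathbf z)$, wherever it applies, the following holds. 1. If $\mathbf z$ is pairwise mean independent, then $\kappa_d(\mathbf z)\in V^{d,n}_{\mathrm{pmi}}$ for every $d\ge 2$ for which the moments of order $d$ exist. 2. Conversely, if $K_{\mathbf z}$ is finite in a neighbourhood of $0$ and $\kappa_d(\mathbf z)\in V^{d,n}_{\mathrm{pmi}}$ for all $d\ge 2$, then $\mathbf z$ is pairwise mean independent. -/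

import Mathlib

open MeasureTheory Finset
open scoped Nat Topology Matrix

noncomputable section

/-- The space `S^d(ℝⁿ)` of real symmetric `n × ⋯ × n` tensors of order `d`. -/
def SymTensor (d n : ℕ) : Submodule ℝ ((Fin d → Fin n) → ℝ) where
  carrier := {T | ∀ (σ : Equiv.Perm (Fin d)) (i : Fin d → Fin n), T (i ∘ σ) = T i}
  zero_mem' := fun _ _ => rfl
  add_mem' := fun {S T} hS hT σ i => by
    simp only [Pi.add_apply]
    rw [hS σ i, hT σ i]
  smul_mem' := fun c T hT σ i => by
    simp only [Pi.smul_apply]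
    rw [hT σ i]

/-- The multi-index `(i, j, …, j)` of length `d`. -/
def headIndex {n : ℕ} (d : ℕ) (i j : Fin n) : Fin d → Fin n :=
  fun k => if (k : ℕ) = 0 then i else j

/-- The linear space of symmetric tensors `T` of order `d` with `T_{ij…j} = 0` for all `i ≠ j`. -/
def Vpmi (d n : ℕ) : Submodule ℝ ((Fin d → Fin n) → ℝ) where
  carrier := {T | T ∈ SymTensor d n ∧ ∀ i j : Fin n, i ≠ j → T (headIndex d i j) = 0}
  zero_mem' := ⟨Submodule.zero_mem _, fun _ _ _ => rfl⟩
  add_mem' := fun {S T} hS hT => ⟨Submodule.add_mem _ hS.1 hT.1, fun i j h => by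
    simp only [Pi.add_apply]
    rw [hS.2 i j h, hT.2 i j h, add_zero]⟩
  smul_mem' := fun c T hT => ⟨Submodule.smul_mem _ c hT.1, fun i j h => by
    simp only [Pi.smul_apply]
    rw [hT.2 i j h, smul_zero]⟩

/-- The random vector `z` is pairwise mean independent: for all `i ≠ j`, the coordinate `z_i` has
an expectation and `E(z_i ∣ z_j) = E(z_i)` almost surely. -/
def PairwiseMeanIndependent {Ω : Type*} [MeasurableSpace Ω] {n : ℕ}
    (z : Ω → Fin n → ℝ) (P : Measure Ω) : Prop :=
  ∀ i j : Fin n, i ≠ j → Integrable (fun ω => z ω i) P ∧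
    P[fun ω => z ω i | MeasurableSpace.comap (fun ω => z ω j) inferInstance]
      =ᵐ[P] fun _ => ∫ ω, z ω i ∂P

/-- All moments `E(z_{i_1} ⋯ z_{i_d})` of order `d` exist. -/
def MomentsExist {Ω : Type*} [MeasurableSpace Ω] {n : ℕ}
    (z : Ω → Fin n → ℝ) (P : Measure Ω) (d : ℕ) : Prop :=
  ∀ i : Fin d → Fin n, Integrable (fun ω => ∏ k, z ω (i k)) P

/-- The cumulant generating function `K_z(t) = log E(exp(tᵀ z))`. -/
def cumulantGenFun {Ω : Type*} [MeasurableSpace Ω] {n : ℕ}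
    (z : Ω → Fin n → ℝ) (P : Measure Ω) (t : Fin n → ℝ) : ℝ :=
  Real.log (∫ ω, Real.exp (t ⬝ᵥ z ω) ∂P)

/-- `K_z` is finite in a neighbourhood of `0`. -/
def CGFFiniteNearZero {Ω : Type*} [MeasurableSpace Ω] {n : ℕ}
    (z : Ω → Fin n → ℝ) (P : Measure Ω) : Prop :=
  ∀ᶠ t : Fin n → ℝ in 𝓝 0, Integrable (fun ω => Real.exp (t ⬝ᵥ z ω)) P

/-- The `d`-th cumulant tensor as the tensor of `d`-th order partial derivatives of `K_z` at `0`;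
meaningful when `K_z` is finite (hence smooth) near `0`. -/
def cgfCumulantTensor {Ω : Type*} [MeasurableSpace Ω] {n : ℕ}
    (z : Ω → Fin n → ℝ) (P : Measure Ω) (d : ℕ) : (Fin d → Fin n) → ℝ :=
  fun i => iteratedFDeriv ℝ d (cumulantGenFun z P) 0 (fun k => Pi.single (i k) 1)

/-- The `d`-th cumulant tensor (`d ≥ 1`) in terms of moments,
`∑_π (-1)^{|π|-1} (|π|-1)! ∏_{B ∈ π} E(∏_{k ∈ B} z_{i_k})`, the sum being over all set partitions
of the `d` positions; meaningful as soon as the moments of order `d` exist. -/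
def momentCumulantTensor {Ω : Type*} [MeasurableSpace Ω] {n : ℕ}
    (z : Ω → Fin n → ℝ) (P : Measure Ω) (d : ℕ) : (Fin d → Fin n) → ℝ :=
  fun i => ∑ π : Finpartition (univ : Finset (Fin d)),
    (-1 : ℝ) ^ (#π.parts - 1) * ((#π.parts - 1)! : ℝ) *
      ∏ B ∈ π.parts, ∫ ω, ∏ k ∈ B, z ω (i k) ∂P

end

/-! Fix `i ≠ j` and put `c = E z_i`. Both descriptions of the cumulants are compared with the
factorization `E(z_i g(z_j)) = c E(g(z_j))`, which mean independence gives whenever `z_i g(z_j)` is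
integrable. Derivatives of `K_z`: on the line `t e_j` the `i`-th partial derivative of `K_z` is
`E(z_i exp(t z_j)) / E(exp(t z_j))`, so the entries `(i, j, …, j)` are the derivatives of this
quotient at `0` (`cgfCumulantTensor_headIndex`). They vanish in every positive order iff the
quotient, being analytic, is the constant `c` near `0`. Moments: if `E(z_i z_j^r) = c E(z_j^r)` for
all lower powers, the partition sum at `(i, j, …, j)` collapses to the defect of this identity at
the top power (`momentCumulantTensor_headIndex`). The collapse comes from the ways of adjoining the
first position to a partition of the others, whose weights cancel. Induction on the power then gives
all mixed moments, and analyticity the exponential identity. Finally `E((z_i - c) exp(t z_j)) = 0`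
near `t = 0` must give `E(z_i ∣ z_j) = c`. The positive and negative parts of `z_i - c` are
densities of two finite measures under which `z_j` has the same moment generating function near `0`,
hence the same image (`setIntegral_preimage_eq_zero`). -/

/-! ### Set partitions: adjoining one element. -/

namespace Finpartition

variable {α : Type*} [DecidableEq α]

/-- Adjoin a new element `a` to the block `B` of a finite partition of `s`; with `B = ∅`, adjoin the
block `{a}`. -/
def insertInto {s : Finset α} (a : α) (ha : a ∉ s) (ρ : Finpartition s) (B : Finset α)
    (hB : B ∈ insert ∅ ρ.parts) : Finpartition (insert a s) :=
  ofExistsUnique (insert (insert a B) (ρ.parts.erase B))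
    (by
      intro p hp
      rcases mem_insert.1 hB with rfl | hB
      · rcases mem_insert.1 hp with rfl | hp
        · simp
        · exact (ρ.subset (mem_of_mem_erase hp)).trans (subset_insert _ _)
      · rcases mem_insert.1 hp with rfl | hp
        · exact insert_subset_insert _ (ρ.subset hB)
        · exact (ρ.subset (mem_of_mem_erase hp)).trans (subset_insert _ _))
    (by
      have hBs : B ⊆ s := by
        rcases mem_insert.1 hB with rfl | hB
        · simp
        · exact ρ.subset hB
      intro x hx
      rcases mem_insert.1 hx with rfl | hx
      · refine ⟨insert x B, ⟨mem_insert_self _ _, mem_insert_self _ _⟩, ?_⟩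
        rintro p ⟨hp, hxp⟩
        rcases mem_insert.1 hp with rfl | hp
        · rfl
        · exact absurd (ρ.subset (mem_of_mem_erase hp) hxp) ha
      · have hxa : x ≠ a := fun h => ha (h ▸ hx)
        by_cases hxB : x ∈ B
        · refine ⟨insert a B, ⟨mem_insert_self _ _, mem_insert_of_mem hxB⟩, ?_⟩
          rintro p ⟨hp, hxp⟩
          rcases mem_insert.1 hp with rfl | hp
          · rfl
          · have hB' : B ∈ ρ.parts := (mem_insert.1 hB).resolve_left (fun h => by simp [h] at hxB)
            exact absurd (ρ.eq_of_mem_parts (mem_of_mem_erase hp) hB' hxp hxB) (ne_of_mem_erase hp)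
        · obtain ⟨t, ⟨ht, hxt⟩, htu⟩ := ρ.existsUnique_mem hx
          refine ⟨t, ⟨mem_insert_of_mem (mem_erase.2 ⟨fun h => hxB (h ▸ hxt), ht⟩), hxt⟩, ?_⟩
          rintro p ⟨hp, hxp⟩
          rcases mem_insert.1 hp with rfl | hp
          · exact absurd ((mem_insert.1 hxp).resolve_left hxa) hxB
          · exact htu p ⟨mem_of_mem_erase hp, hxp⟩)
    (by
      intro h
      rcases mem_insert.1 h with h | h
      · exact (insert_ne_empty _ _) h.symm
      · exact ρ.empty_notMem_parts (mem_of_mem_erase h))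

theorem parts_insertInto {s : Finset α} (a : α) (ha : a ∉ s) (ρ : Finpartition s) (B : Finset α)
    (hB : B ∈ insert ∅ ρ.parts) :
    (insertInto a ha ρ B hB).parts = insert (insert a B) (ρ.parts.erase B) := rfl

theorem part_insertInto {s : Finset α} (a : α) (ha : a ∉ s) (ρ : Finpartition s) (B : Finset α)
    (hB : B ∈ insert ∅ ρ.parts) :
    (insertInto a ha ρ B hB).part a = insert a B :=
  part_eq_of_mem _ (mem_insert_self _ _) (mem_insert_self _ _)

/-- Removing `a` touches only its own block; if that block was `{a}`, the leftover `∅` is discarded.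
-/
theorem parts_avoid_singleton {s : Finset α} {a : α} (ha : a ∈ s) (π : Finpartition s) :
    (π.avoid {a}).parts = (insert ((π.part a).erase a) (π.parts.erase (π.part a))).erase ∅ := by
  have key : ∀ d ∈ π.parts, d ≠ π.part a → a ∉ d := fun d hd hne had =>
    hne (π.part_eq_of_mem hd had).symm
  change (π.parts.image (· \ {a})).erase ∅ = _
  congr 1
  ext c
  simp only [mem_image, mem_insert, mem_erase, sdiff_singleton_eq_erase]
  constructor
  · rintro ⟨d, hd, rfl⟩
    by_cases h : d = π.part a
    · left; rw [h]
    · right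
      rw [erase_eq_of_notMem (key d hd h)]
      exact ⟨h, hd⟩
  · rintro (rfl | ⟨h, hc⟩)
    · exact ⟨_, π.part_mem.2 ha, rfl⟩
    · exact ⟨c, hc, erase_eq_of_notMem (key c hc h)⟩

/-- Partitions of `insert a s` are obtained from partitions of `s` by adjoining `a` to one of the
blocks or as a new block. -/
theorem sum_insert {M : Type*} [AddCommMonoid M] {s : Finset α} {a : α} (ha : a ∉ s)
    (f : Finset (Finset α) → M) :
    ∑ π : Finpartition (insert a s), f π.parts =
      ∑ ρ : Finpartition s, ∑ B ∈ insert ∅ ρ.parts, f (insert (insert a B) (ρ.parts.erase B)) := by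
  rw [sum_sigma']
  symm
  have hs : insert a s \ {a} = s := by rw [sdiff_singleton_eq_erase, erase_insert ha]
  have hmem : a ∈ insert a s := mem_insert_self _ _
  refine sum_bij' (fun x hx => insertInto a ha x.1 x.2 (mem_sigma.1 hx).2)
    (fun π _ => ⟨(π.avoid {a}).copy hs, (π.part a).erase a⟩)
    (fun _ _ => mem_univ _) ?_ ?_ ?_ ?_
  · intro π _
    simp only [mem_sigma, mem_univ, true_and, copy_parts, parts_avoid_singleton hmem]
    by_cases h : (π.part a).erase a = ∅
    · simp [h]
    · exact mem_insert_of_mem (mem_erase.2 ⟨h, mem_insert_self _ _⟩)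
  · rintro ⟨ρ, B⟩ hx
    have hB : B ∈ insert ∅ ρ.parts := (mem_sigma.1 hx).2
    have haB : a ∉ B := by
      rcases mem_insert.1 hB with rfl | hB
      · simp
      · exact fun h => ha (ρ.subset hB h)
    have hB' : ((insertInto a ha ρ B hB).part a).erase a = B := by
      rw [part_insertInto, erase_insert haB]
    refine Sigma.ext ?_ (heq_of_eq hB')
    apply Finpartition.ext
    simp only [copy_parts, parts_avoid_singleton hmem]
    rw [hB', part_insertInto, parts_insertInto, erase_insert]
    · rcases mem_insert.1 hB with rfl | hB
      · rw [erase_eq_of_notMem ρ.empty_notMem_parts, erase_insert ρ.empty_notMem_parts]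
      · rw [Finset.insert_erase hB, erase_eq_of_notMem ρ.empty_notMem_parts]
    · exact fun h => ha (ρ.subset (mem_of_mem_erase h) (mem_insert_self _ _))
  · intro π _
    apply Finpartition.ext
    have hp := π.part_mem.2 hmem
    rw [parts_insertInto]
    simp only [copy_parts, parts_avoid_singleton hmem]
    rw [Finset.insert_erase (π.mem_part_self.2 hmem)]
    have h0 : ∅ ∉ π.parts.erase (π.part a) := fun h => π.empty_notMem_parts (mem_of_mem_erase h)
    have h1 : (π.part a).erase a ∉ π.parts.erase (π.part a) := by
      intro h
      obtain ⟨x, hx⟩ := π.nonempty_of_mem_parts (mem_of_mem_erase h)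
      exact ne_of_mem_erase h (π.eq_of_mem_parts (mem_of_mem_erase h) hp hx (mem_of_mem_erase hx))
    rw [erase_right_comm, erase_insert h1, erase_eq_of_notMem h0, Finset.insert_erase hp]
  · intro x hx
    rw [parts_insertInto]

/-- The cumulant-type sum over partitions of `insert a s` vanishes for a multiplicative family in
which `a` factors out. -/
theorem sum_insert_eq_zero {s : Finset α} {a : α} (ha : a ∉ s) (hs : s.Nonempty) (m : Finset α → ℝ)
    (c : ℝ) (h0 : m ∅ = 1) (hm : ∀ B ⊆ s, m (insert a B) = c * m B) :
    ∑ π : Finpartition (insert a s),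
      (-1 : ℝ) ^ (#π.parts - 1) * ((#π.parts - 1)! : ℝ) * ∏ B ∈ π.parts, m B = 0 := by
  rw [sum_insert ha (fun p => (-1 : ℝ) ^ (#p - 1) * ((#p - 1)! : ℝ) * ∏ B ∈ p, m B)]
  refine sum_eq_zero fun ρ _ => ?_
  have hnot : ∀ B C, insert a B ∉ ρ.parts.erase C := fun B C h =>
    ha (ρ.subset (mem_of_mem_erase h) (mem_insert_self _ _))
  -- This is where `s` must be nonempty: over `s = ∅` the sum is the single term `c`.
  have hne : #ρ.parts ≠ 0 := by
    rw [Finset.card_ne_zero]; exact ρ.parts_nonempty (by simpa using hs.ne_empty)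
  obtain ⟨r, hr⟩ := Nat.exists_eq_succ_of_ne_zero hne
  have hblock : ∀ B ∈ ρ.parts, (-1 : ℝ) ^ (#(insert (insert a B) (ρ.parts.erase B)) - 1) *
      ((#(insert (insert a B) (ρ.parts.erase B)) - 1)! : ℝ) *
        ∏ C ∈ insert (insert a B) (ρ.parts.erase B), m C =
      (-1) ^ r * (r ! : ℝ) * (c * ∏ C ∈ ρ.parts, m C) := by
    intro B hB
    rw [card_insert_of_notMem (hnot _ _), card_erase_of_mem hB, prod_insert (hnot _ _),
      hm B (ρ.subset hB), mul_assoc c, mul_prod_erase _ _ hB, hr]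
    simp
  -- With `r + 1` blocks in `ρ`, enlarging a block contributes `(-1)^r r!` each time and the new
  -- singleton `(-1)^(r+1) (r+1)!`; as `(r+1) r! = (r+1)!`, the total is `0`.
  rw [Finset.sum_insert ρ.empty_notMem_parts, sum_congr rfl hblock, sum_const,
    card_insert_of_notMem (hnot _ _), prod_insert (hnot _ _),
    erase_eq_of_notMem ρ.empty_notMem_parts, hm ∅ (empty_subset _), h0, hr]
  simp only [Nat.add_sub_cancel, Nat.succ_eq_add_one, Nat.factorial_succ, nsmul_eq_mul]
  push_cast
  ring

end Finpartition

/-! ### Exponential integrals with a signed weight. -/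

section Weighted

open ProbabilityTheory

variable {Ω : Type*} [MeasurableSpace Ω] {P : Measure Ω} {h Y : Ω → ℝ}

/-- The measure with density the positive part of `h`. -/
noncomputable def posPartMeasure (P : Measure Ω) (h : Ω → ℝ) : Measure Ω :=
  P.withDensity fun ω => ((h ω).toNNReal : ENNReal)

theorem measurable_neg_fun (hh : Measurable h) : Measurable fun ω => -h ω := hh.neg

theorem integrable_toNNReal_smul (hh : Measurable h) {g : Ω → ℝ} (hg : Measurable g)
    (hI : Integrable (fun ω => h ω * g ω) P) :
    Integrable (fun ω => (h ω).toNNReal • g ω) P := by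
  refine hI.mono (by fun_prop) (.of_forall fun ω => ?_)
  rw [NNReal.smul_def, smul_eq_mul, norm_mul, norm_mul]
  gcongr
  rw [Real.coe_toNNReal', Real.norm_eq_abs, Real.norm_eq_abs, abs_of_nonneg (le_max_right _ _)]
  exact max_le (le_abs_self _) (abs_nonneg _)

theorem integrable_posPartMeasure (hh : Measurable h) {g : Ω → ℝ} (hg : Measurable g)
    (hI : Integrable (fun ω => h ω * g ω) P) : Integrable g (posPartMeasure P h) :=
  (integrable_withDensity_iff_integrable_smul hh.real_toNNReal).2
    (integrable_toNNReal_smul hh hg hI)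

/-- Writing `h` as positive part minus negative part brings the theory of `mgf`, which needs
positive measures, to signed weights. -/
theorem integral_mul_eq_sub_posPartMeasure (hh : Measurable h) {g : Ω → ℝ} (hg : Measurable g)
    (hI : Integrable (fun ω => h ω * g ω) P) :
    ∫ ω, h ω * g ω ∂P =
      ∫ ω, g ω ∂(posPartMeasure P h) - ∫ ω, g ω ∂(posPartMeasure P fun ω => -h ω) := by
  have hI' : Integrable (fun ω => -h ω * g ω) P := by simpa using hI.neg
  rw [posPartMeasure, posPartMeasure, integral_withDensity_eq_integral_smul hh.real_toNNReal,
    integral_withDensity_eq_integral_smul (measurable_neg_fun hh).real_toNNReal,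
    ← integral_sub (integrable_toNNReal_smul hh hg hI) (integrable_toNNReal_smul (measurable_neg_fun hh) hg hI')]
  refine integral_congr_ae (.of_forall fun ω => ?_)
  simp only [NNReal.smul_def, smul_eq_mul, Real.coe_toNNReal', ← sub_mul,
    max_zero_sub_max_neg_zero_eq_self]

theorem zero_mem_interior_integrableExpSet (hh : Measurable h) (hY : Measurable Y)
    (hI : ∀ᶠ t : ℝ in 𝓝 0, Integrable (fun ω => h ω * Real.exp (t * Y ω)) P) :
    0 ∈ interior (integrableExpSet Y (posPartMeasure P h)) := by
  rw [mem_interior_iff_mem_nhds]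
  filter_upwards [hI] with t ht
  exact integrable_posPartMeasure hh (by fun_prop) ht

theorem isFiniteMeasure_posPartMeasure (hh : Measurable h) (hI : Integrable h P) :
    IsFiniteMeasure (posPartMeasure P h) := by
  have : Integrable (fun _ => (1 : ℝ)) (posPartMeasure P h) :=
    integrable_posPartMeasure hh measurable_const (by simpa using hI)
  exact (integrable_const_iff_isFiniteMeasure one_ne_zero).1 this

theorem eventually_neg_integrable
    (hI : ∀ᶠ t : ℝ in 𝓝 0, Integrable (fun ω => h ω * Real.exp (t * Y ω)) P) :
    ∀ᶠ t : ℝ in 𝓝 0, Integrable (fun ω => -h ω * Real.exp (t * Y ω)) P := by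
  filter_upwards [hI] with t ht
  simpa using ht.neg

theorem eventually_integral_mul_exp_eq (hh : Measurable h) (hY : Measurable Y)
    (hI : ∀ᶠ t : ℝ in 𝓝 0, Integrable (fun ω => h ω * Real.exp (t * Y ω)) P) :
    (fun t => ∫ ω, h ω * Real.exp (t * Y ω) ∂P) =ᶠ[𝓝 0]
      mgf Y (posPartMeasure P h) - mgf Y (posPartMeasure P fun ω => -h ω) := by
  filter_upwards [hI] with t ht
  exact integral_mul_eq_sub_posPartMeasure hh (by fun_prop) ht

theorem analyticAt_integral_mul_exp (hh : Measurable h) (hY : Measurable Y)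
    (hI : ∀ᶠ t : ℝ in 𝓝 0, Integrable (fun ω => h ω * Real.exp (t * Y ω)) P) :
    AnalyticAt ℝ (fun t => ∫ ω, h ω * Real.exp (t * Y ω) ∂P) 0 :=
  ((analyticAt_mgf (zero_mem_interior_integrableExpSet hh hY hI)).sub
    (analyticAt_mgf (zero_mem_interior_integrableExpSet (measurable_neg_fun hh) hY
      (eventually_neg_integrable hI)))).congr (eventually_integral_mul_exp_eq hh hY hI).symm

theorem integrable_mul_pow (hh : Measurable h) (hY : Measurable Y)
    (hI : ∀ᶠ t : ℝ in 𝓝 0, Integrable (fun ω => h ω * Real.exp (t * Y ω)) P) (k : ℕ) :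
    Integrable (fun ω => h ω * Y ω ^ k) P := by
  have h1 := (integrable_withDensity_iff_integrable_smul hh.real_toNNReal).1
    (integrable_pow_of_mem_interior_integrableExpSet
      (zero_mem_interior_integrableExpSet hh hY hI) k)
  have h2 := (integrable_withDensity_iff_integrable_smul (measurable_neg_fun hh).real_toNNReal).1
    (integrable_pow_of_mem_interior_integrableExpSet
      (zero_mem_interior_integrableExpSet (measurable_neg_fun hh) hY (eventually_neg_integrable hI)) k)
  refine (h1.sub h2).congr (.of_forall fun ω => ?_)
  simp only [Pi.sub_apply, NNReal.smul_def, smul_eq_mul, Real.coe_toNNReal', ← sub_mul,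
    max_zero_sub_max_neg_zero_eq_self]

theorem iteratedDeriv_integral_mul_exp_zero (hh : Measurable h) (hY : Measurable Y)
    (hI : ∀ᶠ t : ℝ in 𝓝 0, Integrable (fun ω => h ω * Real.exp (t * Y ω)) P) (k : ℕ) :
    iteratedDeriv k (fun t => ∫ ω, h ω * Real.exp (t * Y ω) ∂P) 0 = ∫ ω, h ω * Y ω ^ k ∂P := by
  have h1 := zero_mem_interior_integrableExpSet hh hY hI
  have h2 := zero_mem_interior_integrableExpSet (measurable_neg_fun hh) hY (eventually_neg_integrable hI)
  rw [(eventually_integral_mul_exp_eq hh hY hI).iteratedDeriv_eq k,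
    iteratedDeriv_sub (analyticAt_mgf h1).contDiffAt (analyticAt_mgf h2).contDiffAt,
    iteratedDeriv_mgf_zero h1, iteratedDeriv_mgf_zero h2,
    integral_mul_eq_sub_posPartMeasure hh (by fun_prop) (integrable_mul_pow hh hY hI k)]
  rfl

/-- An analytic function of one real variable is determined near a point by its derivatives. -/
theorem AnalyticAt.eventually_eq_zero_of_iteratedDeriv {f : ℝ → ℝ} {x : ℝ}
    (hf : AnalyticAt ℝ f x) (h0 : ∀ k, iteratedDeriv k f x = 0) : ∀ᶠ t in 𝓝 x, f t = 0 := by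
  rw [← analyticOrderAt_eq_top, ENat.eq_top_iff_forall_ge]
  exact fun n => (natCast_le_analyticOrderAt_iff_iteratedDeriv_eq_zero hf).2 fun i _ => h0 i

/-- Finite measures whose moment generating functions are finite and agree near `0` have the same
image. -/
theorem map_eq_of_mgf_eventuallyEq {μ ν : Measure Ω} [IsFiniteMeasure μ] [IsFiniteMeasure ν]
    (hY : Measurable Y) (hμ : 0 ∈ interior (integrableExpSet Y μ))
    (hν : 0 ∈ interior (integrableExpSet Y ν)) (h : mgf Y μ =ᶠ[𝓝 0] mgf Y ν) :
    μ.map Y = ν.map Y := by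
  let V : Set ℝ := interior (integrableExpSet Y μ) ∩ interior (integrableExpSet Y ν)
  have hV : Convex ℝ V := convex_integrableExpSet.interior.inter convex_integrableExpSet.interior
  -- Identity theorem on a vertical strip: agreement on the real axis near `0` spreads to the
  -- imaginary axis, where `complexMGF` is the characteristic function.
  have key : Set.EqOn (complexMGF Y μ) (complexMGF Y ν) {z | z.re ∈ V} := by
    refine AnalyticOnNhd.eqOn_of_preconnected_of_frequently_eq
      (fun z hz => analyticAt_complexMGF hz.1) (fun z hz => analyticAt_complexMGF hz.2)
      (hV.linear_preimage Complex.reLm).isPreconnected (z₀ := ((0 : ℝ) : ℂ))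
      (by simpa [V] using ⟨hμ, hν⟩) ?_
    have h_real : ∃ᶠ x : ℝ in 𝓝[≠] 0, complexMGF Y μ x = complexMGF Y ν x := by
      refine Filter.Eventually.frequently ?_
      filter_upwards [h.filter_mono nhdsWithin_le_nhds] with x hx
      rw [complexMGF_ofReal, complexMGF_ofReal, hx]
    have ht : Filter.Tendsto (fun x : ℝ => (x : ℂ)) (𝓝[≠] 0) (𝓝[≠] ((0 : ℝ) : ℂ)) :=
      Complex.continuous_ofReal.continuousWithinAt.tendsto_nhdsWithin fun x hx => by simpa using hx
    exact ht.frequently h_real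
  refine Measure.ext_of_charFun ?_
  ext t
  rw [← complexMGF_mul_I hY.aemeasurable, ← complexMGF_mul_I hY.aemeasurable]
  exact key (by simpa [V] using ⟨hμ, hν⟩)

/-- If `E(h exp(tY)) = 0` for all `t` near `0`, then `h` integrates to `0` over every event
determined by `Y`. -/
theorem setIntegral_preimage_eq_zero (hh : Measurable h) (hY : Measurable Y)
    (hI : ∀ᶠ t : ℝ in 𝓝 0, Integrable (fun ω => h ω * Real.exp (t * Y ω)) P)
    (h0 : ∀ᶠ t : ℝ in 𝓝 0, ∫ ω, h ω * Real.exp (t * Y ω) ∂P = 0) {A : Set ℝ}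
    (hA : MeasurableSet A) : ∫ ω in Y ⁻¹' A, h ω ∂P = 0 := by
  have hint : Integrable h P := by simpa using integrable_mul_pow hh hY hI 0
  have : IsFiniteMeasure (posPartMeasure P h) := isFiniteMeasure_posPartMeasure hh hint
  have : IsFiniteMeasure (posPartMeasure P fun ω => -h ω) :=
    isFiniteMeasure_posPartMeasure (measurable_neg_fun hh) hint.neg
  have hmap := map_eq_of_mgf_eventuallyEq hY (zero_mem_interior_integrableExpSet hh hY hI)
    (zero_mem_interior_integrableExpSet (measurable_neg_fun hh) hY (eventually_neg_integrable hI)) (by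
      filter_upwards [h0, eventually_integral_mul_exp_eq hh hY hI] with t h1 h2
      rw [h1] at h2
      exact (sub_eq_zero.1 h2.symm))
  have hYA : MeasurableSet (Y ⁻¹' A) := hY hA
  have hrw : ∀ ω, h ω * (Y ⁻¹' A).indicator 1 ω = (Y ⁻¹' A).indicator h ω := fun ω => by
    by_cases hω : ω ∈ Y ⁻¹' A <;> simp [hω]
  have hmeas : Measurable ((Y ⁻¹' A).indicator (1 : Ω → ℝ)) := measurable_one.indicator hYA
  have hIA : Integrable (fun ω => h ω * (Y ⁻¹' A).indicator 1 ω) P := by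
    simpa only [hrw] using hint.indicator hYA
  -- Tested on the indicator of `Y ⁻¹' A`, the two positive measures give the masses of `A` under
  -- their images by `Y`, which coincide.
  rw [← integral_indicator hYA, ← integral_congr_ae (.of_forall hrw),
    integral_mul_eq_sub_posPartMeasure hh hmeas hIA, integral_indicator_one hYA,
    integral_indicator_one hYA, Measure.real, Measure.real, ← Measure.map_apply hY hA,
    ← Measure.map_apply hY hA, hmap, sub_self]

end Weighted

/-! ### Iterated directional derivatives of smooth functions. -/

section IterDirDeriv

open scoped ContDiff

variable {E : Type*} [NormedAddCommGroup E] [NormedSpace ℝ E]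

/-- The iterated directional derivative along the vectors of a list; the last one acts first. -/
noncomputable def iterDirDeriv (f : E → ℝ) : List E → E → ℝ
  | [] => f
  | v :: l => fun x => fderiv ℝ (iterDirDeriv f l) x v

theorem iterDirDeriv_append (f : E → ℝ) (l₁ l₂ : List E) :
    iterDirDeriv f (l₁ ++ l₂) = iterDirDeriv (iterDirDeriv f l₂) l₁ := by
  induction l₁ with
  | nil => rfl
  | cons v l ih => simp only [List.cons_append, iterDirDeriv, ih]

variable {U : Set E} {f g : E → ℝ}

theorem ContDiffOn.dirDeriv (hU : IsOpen U) (hf : ContDiffOn ℝ ∞ f U) (v : E) :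
    ContDiffOn ℝ ∞ (fun x => fderiv ℝ f x v) U :=
  (hf.fderiv_of_isOpen hU (by simp)).clm_apply contDiffOn_const

theorem ContDiffOn.iterDirDeriv (hU : IsOpen U) (hf : ContDiffOn ℝ ∞ f U) (l : List E) :
    ContDiffOn ℝ ∞ (iterDirDeriv f l) U := by
  induction l with
  | nil => exact hf
  | cons v l ih => exact ih.dirDeriv hU v

theorem Set.EqOn.dirDeriv (hU : IsOpen U) (h : Set.EqOn f g U) (v : E) :
    Set.EqOn (fun x => fderiv ℝ f x v) (fun x => fderiv ℝ g x v) U := fun x hx => by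
  have : f =ᶠ[𝓝 x] g := h.eventuallyEq_of_mem (hU.mem_nhds hx)
  simp only [this.fderiv_eq]

theorem Set.EqOn.iterDirDeriv (hU : IsOpen U) (h : Set.EqOn f g U) (l : List E) :
    Set.EqOn (iterDirDeriv f l) (iterDirDeriv g l) U := by
  induction l with
  | nil => exact h
  | cons v l ih => exact ih.dirDeriv hU v

theorem dirDeriv_comm (hU : IsOpen U) (hf : ContDiffOn ℝ ∞ f U) (v w : E) :
    Set.EqOn (fun x => fderiv ℝ (fun y => fderiv ℝ f y w) x v)
      (fun x => fderiv ℝ (fun y => fderiv ℝ f y v) x w) U := fun x hx => by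
  have hfx : ContDiffAt ℝ ∞ f x := hf.contDiffAt (hU.mem_nhds hx)
  have hd : DifferentiableAt ℝ (fderiv ℝ f) x :=
    (hfx.fderiv_right (m := ∞) (by simp)).differentiableAt (by simp)
  have hsymm : IsSymmSndFDerivAt ℝ f x := hfx.isSymmSndFDerivAt (by
    rw [minSmoothness_of_isRCLikeNormedField]; exact WithTop.coe_le_coe.2 (le_top : (2 : ℕ∞) ≤ ⊤))
  have key : ∀ u : E, fderiv ℝ (fun y => fderiv ℝ f y u) x =
      (fderiv ℝ (fderiv ℝ f) x).flip u := fun u => by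
    rw [fderiv_clm_apply hd (by fun_prop)]; simp
  simp only [key, ContinuousLinearMap.flip_apply]
  exact hsymm v w

/-- Permutations are generated by adjacent swaps, and each swap is the symmetry of a second
derivative. -/
theorem iterDirDeriv_perm (hU : IsOpen U) (hf : ContDiffOn ℝ ∞ f U) {l₁ l₂ : List E}
    (h : l₁.Perm l₂) : Set.EqOn (iterDirDeriv f l₁) (iterDirDeriv f l₂) U := by
  induction h with
  | nil => exact fun _ _ => rfl
  | cons v _ ih => exact ih.dirDeriv hU v
  | swap v w l => exact dirDeriv_comm hU (hf.iterDirDeriv hU l) w v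
  | trans _ _ ih₁ ih₂ => exact ih₁.trans ih₂

theorem iteratedFDeriv_eq_iterDirDeriv (hU : IsOpen U) (hf : ContDiffOn ℝ ∞ f U) {d : ℕ}
    (v : Fin d → E) :
    Set.EqOn (fun x => iteratedFDeriv ℝ d f x v) (iterDirDeriv f (List.ofFn v)) U := by
  induction d with
  | zero => intro x _; simp [iterDirDeriv]
  | succ d ih =>
    intro x hx
    have hfx : ContDiffAt ℝ ∞ f x := hf.contDiffAt (hU.mem_nhds hx)
    have hd : DifferentiableAt ℝ (iteratedFDeriv ℝ d f) x :=
      hfx.differentiableAt_iteratedFDeriv (by exact_mod_cast ENat.natCast_lt_top d)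
    rw [List.ofFn_succ]
    refine Eq.trans ?_ ((ih (fun i => v i.succ)).dirDeriv hU (v 0) hx)
    beta_reduce
    rw [iteratedFDeriv_succ_apply_left,
      fderiv_continuousMultilinear_apply_const_apply hd]
    rfl

/-- Chain rule along a line. The parameter `t` is left free because the induction differentiates in
it. -/
theorem iterDirDeriv_replicate (hU : IsOpen U) (hf : ContDiffOn ℝ ∞ f U) (x v : E) (k : ℕ) :
    ∀ t : ℝ, x + t • v ∈ U → iterDirDeriv f (List.replicate k v) (x + t • v) =
      iteratedDeriv k (fun s : ℝ => f (x + s • v)) t := by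
  induction k with
  | zero => intro t _; simp [iterDirDeriv]
  | succ k ih =>
    intro t ht
    have hline : HasDerivAt (fun s : ℝ => x + s • v) v t := by
      simpa using ((hasDerivAt_id t).smul_const v).const_add x
    have hev : ∀ᶠ s : ℝ in 𝓝 t, x + s • v ∈ U :=
      hline.continuousAt.eventually_mem (hU.mem_nhds ht)
    have hd : DifferentiableAt ℝ (iterDirDeriv f (List.replicate k v)) (x + t • v) :=
      ((hf.iterDirDeriv hU _).contDiffAt (hU.mem_nhds ht)).differentiableAt (by simp)
    rw [iteratedDeriv_succ, ← Filter.EventuallyEq.deriv_eq (hev.mono ih), List.replicate_succ]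
    exact (hd.hasFDerivAt.comp_hasDerivAt t hline).deriv.symm

end IterDirDeriv

/-! ### Differentiation of exponential integrals in several variables. -/

section ExpDotProduct

variable {Ω : Type*} [MeasurableSpace Ω] {P : Measure Ω} {n : ℕ} {z : Ω → Fin n → ℝ}
  {U : Set (Fin n → ℝ)} {h : Ω → ℝ}

/-- The sign vector of `x` turns the left side into one of the summands. Finitely many exponentials
thus control exponential growth in all directions at once. -/
theorem exp_mul_sum_abs_le (x : Fin n → ℝ) (ε : ℝ) :
    Real.exp (ε * ∑ i, |x i|) ≤
      ∑ s : Fin n → SignType, Real.exp ((fun i => ε * (s i : ℝ)) ⬝ᵥ x) := by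
  have : ε * ∑ i, |x i| = (fun i => ε * ((SignType.sign (x i) : SignType) : ℝ)) ⬝ᵥ x := by
    simp only [dotProduct, mul_assoc, sign_mul_self, mul_sum]
  rw [this]
  exact single_le_sum (f := fun s : Fin n → SignType => Real.exp ((fun i => ε * (s i : ℝ)) ⬝ᵥ x))
    (fun _ _ => (Real.exp_pos _).le) (mem_univ fun i => SignType.sign (x i))

theorem exists_integrable_mul_exp_sum_abs (hz : Measurable z) (hh : Measurable h) (hU : IsOpen U)
    (hI : ∀ t ∈ U, Integrable (fun ω => h ω * Real.exp (t ⬝ᵥ z ω)) P) {t : Fin n → ℝ}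
    (ht : t ∈ U) : ∃ ε > 0,
      Integrable (fun ω => |h ω| * Real.exp (t ⬝ᵥ z ω) * Real.exp (ε * ∑ i, |z ω i|)) P := by
  obtain ⟨δ, hδ, hball⟩ := Metric.isOpen_iff.1 hU t ht
  refine ⟨δ / 2, half_pos hδ, ?_⟩
  have hmem : ∀ s : Fin n → SignType, t + (fun i => δ / 2 * (s i : ℝ)) ∈ U := fun s => by
    refine hball ?_
    rw [Metric.mem_ball, dist_eq_norm, add_sub_cancel_left, pi_norm_lt_iff hδ]
    intro i
    rw [norm_mul, Real.norm_of_nonneg (half_pos hδ).le]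
    have : ‖((s i : SignType) : ℝ)‖ ≤ 1 := by cases s i <;> simp
    nlinarith
  have hsum := integrable_finsetSum univ fun s _ => (hI _ (hmem s)).abs
  refine hsum.mono (by unfold dotProduct; fun_prop) (.of_forall fun ω => ?_)
  rw [Real.norm_of_nonneg (by positivity), Real.norm_of_nonneg (by positivity)]
  refine (mul_le_mul_of_nonneg_left (exp_mul_sum_abs_le (z ω) (δ / 2)) (by positivity)).trans ?_
  rw [mul_sum]
  refine sum_le_sum fun s _ => le_of_eq ?_
  rw [abs_mul, Real.abs_exp, add_dotProduct, Real.exp_add, mul_assoc]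

theorem mul_exp_le_exp_two_mul {ε S : ℝ} (hε : 0 < ε) :
    S * Real.exp (ε * S) ≤ ε⁻¹ * Real.exp (2 * ε * S) := by
  have h1 : ε * S ≤ Real.exp (ε * S) := by linarith [Real.add_one_le_exp (ε * S)]
  have h2 : S ≤ ε⁻¹ * Real.exp (ε * S) := by
    rw [le_inv_mul_iff₀ hε]; exact h1
  calc S * Real.exp (ε * S) ≤ ε⁻¹ * Real.exp (ε * S) * Real.exp (ε * S) := by gcongr
    _ = ε⁻¹ * Real.exp (2 * ε * S) := by
      rw [mul_assoc, ← Real.exp_add]; ring_nf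

/-- The linear form `t ↦ tᵀ x`. -/
noncomputable def dotProductCLM (x : Fin n → ℝ) : (Fin n → ℝ) →L[ℝ] ℝ :=
  ∑ i, x i • ContinuousLinearMap.proj i

theorem dotProductCLM_apply (x t : Fin n → ℝ) : dotProductCLM x t = t ⬝ᵥ x := by
  simp [dotProductCLM, dotProduct, mul_comm]

theorem continuous_dotProductCLM :
    Continuous (dotProductCLM : (Fin n → ℝ) → (Fin n → ℝ) →L[ℝ] ℝ) :=
  continuous_finsetSum _ fun i _ => (continuous_apply i).smul continuous_const

theorem norm_dotProductCLM_le (x : Fin n → ℝ) : ‖dotProductCLM x‖ ≤ ∑ i, |x i| := by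
  refine ContinuousLinearMap.opNorm_le_bound _ (sum_nonneg fun _ _ => abs_nonneg _) fun t => ?_
  rw [dotProductCLM_apply, dotProduct, sum_mul]
  refine (norm_sum_le _ _).trans (sum_le_sum fun i _ => ?_)
  rw [norm_mul, mul_comm, Real.norm_eq_abs (x i)]
  gcongr
  exact norm_le_pi_norm t i

/-- A majorant, uniform in `s`, for the derivative of the integrand, as needed to differentiate
under the integral. -/
theorem exists_integrable_bound (hz : Measurable z) (hh : Measurable h) (hU : IsOpen U)
    (hI : ∀ t ∈ U, Integrable (fun ω => h ω * Real.exp (t ⬝ᵥ z ω)) P) {t : Fin n → ℝ}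
    (ht : t ∈ U) : ∃ ε > 0, ∃ b : Ω → ℝ, Integrable b P ∧
      ∀ s ∈ Metric.ball t ε, ∀ ω, |h ω| * Real.exp (s ⬝ᵥ z ω) * ∑ i, |z ω i| ≤ b ω := by
  obtain ⟨ε, hε, hint⟩ := exists_integrable_mul_exp_sum_abs hz hh hU hI ht
  -- Half of the exponential margin `ε` pays for moving from `t` to `s`, the other half absorbs the
  -- linear factor.
  refine ⟨ε / 2, half_pos hε, _, hint.const_mul (ε / 2)⁻¹, fun s hs ω => ?_⟩
  have hS : (0 : ℝ) ≤ ∑ i, |z ω i| := sum_nonneg fun _ _ => abs_nonneg _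
  have h1 : s ⬝ᵥ z ω ≤ t ⬝ᵥ z ω + ε / 2 * ∑ i, |z ω i| := by
    have : (s - t) ⬝ᵥ z ω ≤ ε / 2 * ∑ i, |z ω i| := by
      rw [← dotProductCLM_apply]
      calc _ ≤ ‖dotProductCLM (z ω) (s - t)‖ := le_abs_self _
        _ ≤ ‖dotProductCLM (z ω)‖ * ‖s - t‖ := ContinuousLinearMap.le_opNorm _ _
        _ ≤ (∑ i, |z ω i|) * (ε / 2) := by
          gcongr
          · exact norm_dotProductCLM_le _
          · rw [← dist_eq_norm]; exact (Metric.mem_ball.1 hs).le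
        _ = _ := mul_comm _ _
    rw [sub_dotProduct] at this
    linarith
  calc |h ω| * Real.exp (s ⬝ᵥ z ω) * ∑ i, |z ω i|
      ≤ |h ω| * Real.exp (t ⬝ᵥ z ω + ε / 2 * ∑ i, |z ω i|) * ∑ i, |z ω i| := by gcongr
    _ = |h ω| * Real.exp (t ⬝ᵥ z ω) *
        ((∑ i, |z ω i|) * Real.exp (ε / 2 * ∑ i, |z ω i|)) := by rw [Real.exp_add]; ring
    _ ≤ |h ω| * Real.exp (t ⬝ᵥ z ω) *
        ((ε / 2)⁻¹ * Real.exp (2 * (ε / 2) * ∑ i, |z ω i|)) := by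
      exact mul_le_mul_of_nonneg_left (mul_exp_le_exp_two_mul (half_pos hε)) (by positivity)
    _ = _ := by
      rw [show 2 * (ε / 2) = ε by ring]; ring

theorem integrable_mul_coord_mul_exp (hz : Measurable z) (hh : Measurable h) (hU : IsOpen U)
    (hI : ∀ t ∈ U, Integrable (fun ω => h ω * Real.exp (t ⬝ᵥ z ω)) P) (i : Fin n) :
    ∀ t ∈ U, Integrable (fun ω => h ω * z ω i * Real.exp (t ⬝ᵥ z ω)) P := by
  intro t ht
  obtain ⟨ε, hε, b, hb, hle⟩ := exists_integrable_bound hz hh hU hI ht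
  refine hb.mono' (by unfold dotProduct; fun_prop) (.of_forall fun ω => ?_)
  refine le_trans ?_ (hle t (Metric.mem_ball_self hε) ω)
  rw [norm_mul, norm_mul, Real.norm_eq_abs, Real.norm_eq_abs, Real.norm_eq_abs, Real.abs_exp,
    mul_right_comm]
  gcongr
  exact single_le_sum (f := fun i => |z ω i|) (fun _ _ => abs_nonneg _) (mem_univ i)

theorem hasFDerivAt_integral_mul_exp (hz : Measurable z) (hh : Measurable h) (hU : IsOpen U)
    (hI : ∀ t ∈ U, Integrable (fun ω => h ω * Real.exp (t ⬝ᵥ z ω)) P) {t : Fin n → ℝ}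
    (ht : t ∈ U) :
    HasFDerivAt (fun t => ∫ ω, h ω * Real.exp (t ⬝ᵥ z ω) ∂P)
      (dotProductCLM fun i => ∫ ω, h ω * z ω i * Real.exp (t ⬝ᵥ z ω) ∂P) t := by
  obtain ⟨ε, hε, b, hb, hle⟩ := exists_integrable_bound hz hh hU hI ht
  have hF' : ∀ ω (s : Fin n → ℝ), (h ω * Real.exp (s ⬝ᵥ z ω)) • dotProductCLM (z ω) =
      ∑ i, (h ω * z ω i * Real.exp (s ⬝ᵥ z ω)) •
        (ContinuousLinearMap.proj i : (Fin n → ℝ) →L[ℝ] ℝ) := fun ω s => by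
    rw [dotProductCLM, smul_sum]
    refine sum_congr rfl fun i _ => ?_
    rw [smul_smul, mul_right_comm]
  have hint := integrable_mul_coord_mul_exp hz hh hU hI
  have key := hasFDerivAt_integral_of_dominated_of_fderiv_le (μ := P)
    (F := fun t ω => h ω * Real.exp (t ⬝ᵥ z ω))
    (F' := fun s ω => (h ω * Real.exp (s ⬝ᵥ z ω)) • dotProductCLM (z ω)) (x₀ := t)
    (Metric.ball_mem_nhds t hε) (bound := b)
    (.of_forall fun s => by unfold dotProduct; fun_prop) (hI t ht)
    ((hI t ht).aestronglyMeasurable.smul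
      (continuous_dotProductCLM.comp_aestronglyMeasurable hz.aestronglyMeasurable))
    (.of_forall fun ω s hs => by
      refine le_trans ?_ (hle s hs ω)
      rw [norm_smul, norm_mul, Real.norm_eq_abs, Real.norm_eq_abs, Real.abs_exp]
      gcongr
      exact norm_dotProductCLM_le _)
    hb
    (.of_forall fun ω s _ => by
      have h1 : HasFDerivAt (fun s => s ⬝ᵥ z ω) (dotProductCLM (z ω)) s := by
        simpa only [← dotProductCLM_apply] using (dotProductCLM (z ω)).hasFDerivAt
      simpa only [smul_smul] using h1.exp.const_mul (h ω))
  refine key.congr_fderiv ?_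
  have hint' : ∀ i ∈ univ, Integrable (fun ω => (h ω * z ω i * Real.exp (t ⬝ᵥ z ω)) •
      (ContinuousLinearMap.proj i : (Fin n → ℝ) →L[ℝ] ℝ)) P :=
    fun i _ => (hint i t ht).smul_const _
  simp only [hF']
  rw [integral_finsetSum _ hint', dotProductCLM]
  exact sum_congr rfl fun i _ => integral_smul_const _ _

/-- Each partial derivative is an integral of the same kind with weight `h * z_i`, so the induction
runs over all weights simultaneously. -/
theorem contDiffOn_integral_mul_exp (hz : Measurable z) (hh : Measurable h) (hU : IsOpen U)
    (hI : ∀ t ∈ U, Integrable (fun ω => h ω * Real.exp (t ⬝ᵥ z ω)) P) :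
    ContDiffOn ℝ (⊤ : ℕ∞) (fun t => ∫ ω, h ω * Real.exp (t ⬝ᵥ z ω) ∂P) U := by
  rw [contDiffOn_infty]
  intro k
  induction k generalizing h with
  | zero =>
    exact contDiffOn_zero.2 fun t ht =>
      (hasFDerivAt_integral_mul_exp hz hh hU hI ht).continuousAt.continuousWithinAt
  | succ k ih =>
    push_cast
    rw [contDiffOn_succ_iff_fderiv_of_isOpen hU]
    refine ⟨fun t ht => (hasFDerivAt_integral_mul_exp hz hh hU hI
      ht).differentiableAt.differentiableWithinAt, by simp, ?_⟩
    have hsum : ContDiffOn ℝ k (fun t => ∑ i, (∫ ω, h ω * z ω i * Real.exp (t ⬝ᵥ z ω) ∂P) •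
        (ContinuousLinearMap.proj i : (Fin n → ℝ) →L[ℝ] ℝ)) U :=
      ContDiffOn.sum fun i _ => (ih (h := fun ω => h ω * z ω i) (by fun_prop)
        (integrable_mul_coord_mul_exp hz hh hU hI i)).smul contDiffOn_const
    exact hsum.congr fun t ht => (hasFDerivAt_integral_mul_exp hz hh hU hI ht).fderiv

end ExpDotProduct

/-! ### Cumulants as partition sums of moments. -/

section MomentCumulants

variable {Ω : Type*} [MeasurableSpace Ω] {P : Measure Ω} {n : ℕ} {z : Ω → Fin n → ℝ}

/-- If `m (insert a B) = c * m B` for all `B` avoiding `a` that do not exhaust the complement of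
`a`, then the cumulant-type sum over the partitions of a finite type only retains the defect of
multiplicativity of the full set. -/
theorem Finpartition.sum_univ_eq_sub {α : Type*} [Fintype α] [DecidableEq α] [Nontrivial α] (a : α)
    (m : Finset α → ℝ) (c : ℝ) (h0 : m ∅ = 1)
    (hm : ∀ B, a ∉ B → B ≠ univ.erase a → m (insert a B) = c * m B) :
    ∑ π : Finpartition (univ : Finset α),
      (-1 : ℝ) ^ (#π.parts - 1) * ((#π.parts - 1)! : ℝ) * ∏ B ∈ π.parts, m B =
      m univ - c * m (univ.erase a) := by
  -- Correcting `m` at `univ` alone makes `a` factor out everywhere, so the sum for `m'` vanishes.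
  -- The two sums differ only at the one-block partition, whose coefficient is `1`.
  let m' : Finset α → ℝ := Function.update m univ (c * m (univ.erase a))
  have hm' : ∀ B ≠ univ, m' B = m B := fun B hB => Function.update_of_ne hB _ _
  have huniv : (univ : Finset α) ≠ ∅ := univ_nonempty.ne_empty
  have key : ∀ s : Finset α, insert a (univ.erase a) = s → ∑ π : Finpartition s,
      (-1 : ℝ) ^ (#π.parts - 1) * ((#π.parts - 1)! : ℝ) * ∏ B ∈ π.parts, m' B = 0 := by
    rintro s rfl
    refine sum_insert_eq_zero (notMem_erase a univ) ?_ m' c ?_ fun B hB => ?_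
    · obtain ⟨b, hb⟩ := exists_ne a
      exact ⟨b, mem_erase.2 ⟨hb, mem_univ b⟩⟩
    · rw [hm' _ huniv.symm, h0]
    · have haB : a ∉ B := fun h => notMem_erase a univ (hB h)
      have hBu : B ≠ univ := fun h => haB (h ▸ mem_univ a)
      rw [hm' B hBu]
      by_cases hBe : B = univ.erase a
      · rw [hBe, Finset.insert_erase (mem_univ a)]
        exact Function.update_self _ _ _
      · rw [hm' _ ?_, hm B haB hBe]
        rintro h
        exact hBe (by rw [← h, erase_insert haB])
  rw [← sub_zero (∑ π : Finpartition (univ : Finset α), _),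
    ← key univ (Finset.insert_erase (mem_univ a)), ← sum_sub_distrib,
    sum_eq_single (indiscrete (by exact huniv))]
  · simp only [indiscrete, card_singleton, prod_singleton]
    simp [m']
  · intro π _ hπ
    have hnot : univ ∉ π.parts := fun h => hπ <| by
      apply Finpartition.ext
      ext B
      simp only [indiscrete, mem_singleton]
      refine ⟨fun hB => ?_, fun hB => hB ▸ h⟩
      obtain ⟨x, hx⟩ := π.nonempty_of_mem_parts hB
      exact π.eq_of_mem_parts hB h hx (mem_univ x)
    rw [prod_congr rfl fun B hB => hm' B fun h => hnot (h ▸ hB), sub_self]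
  · exact fun h => absurd (mem_univ _) h

theorem Finpartition.sum_map_perm {α M : Type*} [Fintype α] [DecidableEq α] [AddCommMonoid M]
    (σ : Equiv.Perm α) (f : Finset (Finset α) → M) :
    ∑ π : Finpartition (univ : Finset α), f (π.parts.map σ.finsetCongr.toEmbedding) =
      ∑ π : Finpartition (univ : Finset α), f π.parts := by
  let e : Finset α ≃o Finset α := ⟨σ.finsetCongr, by simp⟩
  let F : Finpartition (univ : Finset α) → Finpartition (univ : Finset α) :=
    fun π => (π.map e).copy (by simp [e])
  have hF : ∀ π, (F π).parts = π.parts.map σ.finsetCongr.toEmbedding := fun π => rfl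
  have hinj : Function.Injective F := fun π ρ h => by
    apply Finpartition.ext
    have := congrArg Finpartition.parts h
    rw [hF, hF] at this
    exact Finset.map_injective _ this
  exact Fintype.sum_bijective F (Finite.injective_iff_bijective.1 hinj) _ _ fun π => by rw [hF]

theorem momentCumulantTensor_mem_symTensor (z : Ω → Fin n → ℝ) (P : Measure Ω) (d : ℕ) :
    momentCumulantTensor z P d ∈ SymTensor d n := by
  intro σ i
  refine Eq.trans (sum_congr rfl fun π _ => ?_) (Finpartition.sum_map_perm σ (fun p =>
    (-1 : ℝ) ^ (#p - 1) * ((#p - 1)! : ℝ) * ∏ B ∈ p, ∫ ω, ∏ k ∈ B, z ω (i k) ∂P))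
  simp

/-- Position `0` plays the role of the distinguished element, and a block avoiding it gives a pure
power of `z_j`. Factorization is assumed only up to power `d`; the tensor entry measures its failure
at power `d + 1`. -/
theorem momentCumulantTensor_headIndex [IsProbabilityMeasure P] {d : ℕ} (i j : Fin n) (c : ℝ)
    (hc : ∀ r ≤ d, ∫ ω, z ω i * z ω j ^ r ∂P = c * ∫ ω, z ω j ^ r ∂P) :
    momentCumulantTensor z P (d + 2) (headIndex (d + 2) i j) =
      ∫ ω, z ω i * z ω j ^ (d + 1) ∂P - c * ∫ ω, z ω j ^ (d + 1) ∂P := by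
  have h1 : ∀ B : Finset (Fin (d + 2)), 0 ∉ B → ∀ ω,
      ∏ k ∈ B, z ω (headIndex (d + 2) i j k) = z ω j ^ #B := fun B hB ω => by
    rw [← prod_const]
    refine prod_congr rfl fun k hk => ?_
    have : (k : ℕ) ≠ 0 := fun h => hB ((Fin.ext h : k = 0) ▸ hk)
    simp [headIndex, this]
  have h2 : ∀ B : Finset (Fin (d + 2)), 0 ∉ B → ∀ ω,
      ∏ k ∈ insert 0 B, z ω (headIndex (d + 2) i j k) = z ω i * z ω j ^ #B := fun B hB ω => by
    rw [prod_insert hB, h1 B hB]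
    simp [headIndex]
  have hcard : #((univ : Finset (Fin (d + 2))).erase 0) = d + 1 := by
    rw [card_erase_of_mem (mem_univ _), card_univ, Fintype.card_fin]; rfl
  rw [momentCumulantTensor, Finpartition.sum_univ_eq_sub (0 : Fin (d + 2))
    (fun B => ∫ ω, ∏ k ∈ B, z ω (headIndex (d + 2) i j k) ∂P) c (by simp)]
  · have h3 := h2 (univ.erase 0) (notMem_erase _ _)
    rw [Finset.insert_erase (mem_univ _)] at h3
    simp only [h3, h1 _ (notMem_erase _ _), hcard]
  · intro B hB hBne
    simp only [h1 B hB, h2 B hB]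
    have hlt := card_lt_card ((Finset.subset_erase.2 ⟨subset_univ _, hB⟩).ssubset_of_ne hBne)
    exact hc _ (Nat.lt_succ_iff.1 (hlt.trans_eq hcard))

end MomentCumulants

/-! ### Mean independence and test functions. -/

section MeanIndependence

variable {Ω : Type*} [MeasurableSpace Ω] {P : Measure Ω} {X Y : Ω → ℝ}

theorem integral_mul_eq_of_condExp_eq_const [IsProbabilityMeasure P] (hY : Measurable Y)
    (hX : Integrable X P) {c : ℝ}
    (hc : P[X | MeasurableSpace.comap Y inferInstance] =ᵐ[P] fun _ => c) {g : ℝ → ℝ}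
    (hg : Measurable g) (hI : Integrable (fun ω => X ω * g (Y ω)) P) :
    ∫ ω, X ω * g (Y ω) ∂P = c * ∫ ω, g (Y ω) ∂P := by
  have hm : MeasurableSpace.comap Y inferInstance ≤ ‹MeasurableSpace Ω› := hY.comap_le
  have hgY : StronglyMeasurable[MeasurableSpace.comap Y inferInstance] fun ω => g (Y ω) :=
    (hg.comp (comap_measurable Y)).stronglyMeasurable
  have key := condExp_mul_of_stronglyMeasurable_right hgY hI hX
  -- Pulling `c` out of the integral needs no integrability of `g (Y ω)`, so only the product has to
  -- be integrable.
  rw [← integral_condExp hm, ← integral_const_mul]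
  refine integral_congr_ae ?_
  filter_upwards [key, hc] with ω h1 h2
  refine h1.trans ?_
  rw [Pi.mul_apply, h2]

theorem condExp_eq_const_of_integral_mul_exp [IsProbabilityMeasure P] (hX : Measurable X)
    (hY : Measurable Y) {c : ℝ}
    (hXI : ∀ᶠ t : ℝ in 𝓝 0, Integrable (fun ω => X ω * Real.exp (t * Y ω)) P)
    (hI : ∀ᶠ t : ℝ in 𝓝 0, Integrable (fun ω => Real.exp (t * Y ω)) P)
    (h : ∀ᶠ t : ℝ in 𝓝 0,
      ∫ ω, X ω * Real.exp (t * Y ω) ∂P = c * ∫ ω, Real.exp (t * Y ω) ∂P) :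
    P[X | MeasurableSpace.comap Y inferInstance] =ᵐ[P] fun _ => c := by
  have hXint : Integrable X P := by simpa using hXI.self_of_nhds
  have hsub : ∀ᶠ t : ℝ in 𝓝 0, Integrable (fun ω => (X ω - c) * Real.exp (t * Y ω)) P := by
    filter_upwards [hXI, hI] with t h1 h2
    refine (h1.sub (h2.const_mul c)).congr (.of_forall fun ω => ?_)
    simp only [Pi.sub_apply, sub_mul]
  have hzero : ∀ᶠ t : ℝ in 𝓝 0, ∫ ω, (X ω - c) * Real.exp (t * Y ω) ∂P = 0 := by
    filter_upwards [hXI, hI, h] with t h1 h2 h3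
    simp only [sub_mul]
    rw [integral_sub h1 (h2.const_mul c), integral_const_mul, h3, sub_self]
  refine (ae_eq_condExp_of_forall_setIntegral_eq hY.comap_le hXint
    (fun _ _ _ => (integrable_const c).integrableOn) ?_ aestronglyMeasurable_const).symm
  rintro _ ⟨A, hA, rfl⟩ _
  have := setIntegral_preimage_eq_zero (hX.sub_const c) hY hsub hzero hA
  rw [integral_sub hXint.integrableOn (integrable_const c).integrableOn] at this
  exact (sub_eq_zero.1 this).symm

end MeanIndependence

/-! ### Smoothness and derivatives of the cumulant generating function. -/

section CumulantGenFun

variable {Ω : Type*} [MeasurableSpace Ω] {P : Measure Ω} {n : ℕ} {z : Ω → Fin n → ℝ}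

/-- The interior of the domain of finiteness of `K_z`. -/
def cgfDomain (z : Ω → Fin n → ℝ) (P : Measure Ω) : Set (Fin n → ℝ) :=
  interior {t | Integrable (fun ω => Real.exp (t ⬝ᵥ z ω)) P}

theorem isOpen_cgfDomain : IsOpen (cgfDomain z P) := isOpen_interior

theorem integrable_of_mem_cgfDomain {t : Fin n → ℝ} (ht : t ∈ cgfDomain z P) :
    Integrable (fun ω => 1 * Real.exp (t ⬝ᵥ z ω)) P := by
  simpa only [one_mul, Set.mem_ofPred_eq] using interior_subset ht

theorem zero_mem_cgfDomain (h : CGFFiniteNearZero z P) : 0 ∈ cgfDomain z P :=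
  mem_interior_iff_mem_nhds.2 h

theorem smul_single_dotProduct (t : ℝ) (j : Fin n) (x : Fin n → ℝ) :
    (t • Pi.single j (1 : ℝ)) ⬝ᵥ x = t * x j := by
  rw [smul_dotProduct, single_one_dotProduct, smul_eq_mul]

theorem eventually_smul_single_mem_cgfDomain (h : CGFFiniteNearZero z P) (j : Fin n) :
    ∀ᶠ t : ℝ in 𝓝 0, t • Pi.single j (1 : ℝ) ∈ cgfDomain z P := by
  have hc : ContinuousAt (fun t : ℝ => t • (Pi.single j (1 : ℝ) : Fin n → ℝ)) 0 := by fun_prop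
  exact hc.eventually_mem (isOpen_cgfDomain.mem_nhds (by simpa using zero_mem_cgfDomain h))

theorem eventually_integrable_exp (h : CGFFiniteNearZero z P) (j : Fin n) :
    ∀ᶠ t : ℝ in 𝓝 0, Integrable (fun ω => Real.exp (t * z ω j)) P := by
  filter_upwards [eventually_smul_single_mem_cgfDomain h j] with t ht
  simpa only [smul_single_dotProduct, one_mul] using integrable_of_mem_cgfDomain ht

theorem eventually_integrable_coord_mul_exp (hz : Measurable z) (h : CGFFiniteNearZero z P)
    (i j : Fin n) :
    ∀ᶠ t : ℝ in 𝓝 0, Integrable (fun ω => z ω i * Real.exp (t * z ω j)) P := by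
  filter_upwards [eventually_smul_single_mem_cgfDomain h j] with t ht
  simpa only [smul_single_dotProduct, one_mul] using integrable_mul_coord_mul_exp hz
    measurable_const isOpen_cgfDomain (fun _ => integrable_of_mem_cgfDomain) i _ ht

theorem integral_exp_dotProduct_pos [IsProbabilityMeasure P] {t : Fin n → ℝ}
    (ht : t ∈ cgfDomain z P) : 0 < ∫ ω, Real.exp (t ⬝ᵥ z ω) ∂P :=
  integral_exp_pos (by simpa only [one_mul] using integrable_of_mem_cgfDomain ht)

theorem contDiffOn_cumulantGenFun [IsProbabilityMeasure P] (hz : Measurable z) :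
    ContDiffOn ℝ (⊤ : ℕ∞) (cumulantGenFun z P) (cgfDomain z P) := by
  have h := contDiffOn_integral_mul_exp (P := P) hz (measurable_const (a := (1 : ℝ)))
    isOpen_cgfDomain fun t (ht : t ∈ cgfDomain z P) => integrable_of_mem_cgfDomain ht
  simp only [one_mul] at h
  exact h.log fun t ht => (integral_exp_dotProduct_pos ht).ne'

theorem fderiv_cumulantGenFun_single [IsProbabilityMeasure P] (hz : Measurable z) (i : Fin n)
    {t : Fin n → ℝ} (ht : t ∈ cgfDomain z P) :
    fderiv ℝ (cumulantGenFun z P) t (Pi.single i 1) =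
      (∫ ω, z ω i * Real.exp (t ⬝ᵥ z ω) ∂P) / ∫ ω, Real.exp (t ⬝ᵥ z ω) ∂P := by
  have h := hasFDerivAt_integral_mul_exp (P := P) hz (measurable_const (a := (1 : ℝ)))
    isOpen_cgfDomain (fun t (ht : t ∈ cgfDomain z P) => integrable_of_mem_cgfDomain ht) ht
  simp only [one_mul] at h
  have hlog := (h.log (integral_exp_dotProduct_pos ht).ne').fderiv
  change fderiv ℝ (cumulantGenFun z P) t = _ at hlog
  rw [hlog, _root_.smul_apply, dotProductCLM_apply, single_one_dotProduct,
    smul_eq_mul, div_eq_inv_mul]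

theorem cgfCumulantTensor_mem_symTensor [IsProbabilityMeasure P] (hz : Measurable z)
    (h : CGFFiniteNearZero z P) (d : ℕ) : cgfCumulantTensor z P d ∈ SymTensor d n := by
  intro σ i
  have key := iteratedFDeriv_eq_iterDirDeriv isOpen_cgfDomain
    (contDiffOn_cumulantGenFun (P := P) hz) (d := d)
  refine (key _ (zero_mem_cgfDomain h)).trans (Eq.trans ?_ (key _ (zero_mem_cgfDomain h)).symm)
  exact iterDirDeriv_perm isOpen_cgfDomain (contDiffOn_cumulantGenFun hz)
    (Equiv.Perm.ofFn_comp_perm σ fun k => Pi.single (i k) (1 : ℝ)) (zero_mem_cgfDomain h)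

theorem cgfCumulantTensor_headIndex [IsProbabilityMeasure P] (hz : Measurable z)
    (h : CGFFiniteNearZero z P) (d : ℕ) (i j : Fin n) :
    cgfCumulantTensor z P (d + 1) (headIndex (d + 1) i j) =
      iteratedDeriv d (fun t : ℝ => (∫ ω, z ω i * Real.exp (t * z ω j) ∂P) /
        ∫ ω, Real.exp (t * z ω j) ∂P) 0 := by
  have hK := contDiffOn_cumulantGenFun (P := P) hz
  have h0 := zero_mem_cgfDomain h
  have hlist : (List.ofFn fun k : Fin (d + 1) =>
      (Pi.single (headIndex (d + 1) i j k) 1 : Fin n → ℝ)) =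
      [Pi.single i 1] ++ List.replicate d (Pi.single j 1) := by
    rw [List.ofFn_succ]
    simp [headIndex, List.ofFn_const]
  have hG := hK.dirDeriv isOpen_cgfDomain (Pi.single i (1 : ℝ))
  refine (iteratedFDeriv_eq_iterDirDeriv isOpen_cgfDomain hK _ h0).trans ?_
  -- Reordering makes the single `i`-derivative act first, where it is explicit; the remaining `d`
  -- derivatives stay on the line through `e_j`.
  rw [hlist, iterDirDeriv_perm isOpen_cgfDomain hK List.perm_append_comm h0, iterDirDeriv_append]
  have hrep := iterDirDeriv_replicate isOpen_cgfDomain hG 0 (Pi.single j (1 : ℝ)) d 0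
    (by simpa using h0)
  rw [zero_smul, add_zero] at hrep
  refine hrep.trans (Filter.EventuallyEq.iteratedDeriv_eq d ?_)
  filter_upwards [eventually_smul_single_mem_cgfDomain h j] with t ht
  simp only [zero_add, fderiv_cumulantGenFun_single hz i ht, smul_single_dotProduct]

end CumulantGenFun

/-! ### The equivalence for both descriptions of the cumulants. -/

theorem theorem2p2 {Ω : Type*} [MeasurableSpace Ω] (P : Measure Ω) [IsProbabilityMeasure P]
    {n : ℕ} (z : Ω → Fin n → ℝ) (hz : Measurable z) :
    (PairwiseMeanIndependent z P →
      ∀ d : ℕ, 2 ≤ d → MomentsExist z P d → momentCumulantTensor z P d ∈ Vpmi d n) ∧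
    (PairwiseMeanIndependent z P → CGFFiniteNearZero z P →
      ∀ d : ℕ, 2 ≤ d → cgfCumulantTensor z P d ∈ Vpmi d n) ∧
    (CGFFiniteNearZero z P →
      (∀ d : ℕ, 2 ≤ d → momentCumulantTensor z P d ∈ Vpmi d n) →
      PairwiseMeanIndependent z P) ∧
    (CGFFiniteNearZero z P →
      (∀ d : ℕ, 2 ≤ d → cgfCumulantTensor z P d ∈ Vpmi d n) →
      PairwiseMeanIndependent z P) := by
  have hzi : ∀ i, Measurable fun ω => z ω i := fun i => by fun_prop
  refine ⟨fun hmi d hd hmom => ⟨momentCumulantTensor_mem_symTensor z P d, fun i j hij => ?_⟩,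
    fun hmi hfin d hd => ⟨cgfCumulantTensor_mem_symTensor hz hfin d, fun i j hij => ?_⟩,
    fun hfin hV i j hij => ?_, fun hfin hV i j hij => ?_⟩
  · obtain ⟨d, rfl⟩ := Nat.exists_eq_add_of_le' hd
    obtain ⟨hX, hc⟩ := hmi i j hij
    have htop : Integrable (fun ω => z ω i * z ω j ^ (d + 1)) P := by
      refine (hmom (headIndex (d + 2) i j)).congr (.of_forall fun ω => ?_)
      simp [Fin.prod_univ_succ, headIndex]
    -- Lower mixed moments exist because `|z_j|^r ≤ 1 + |z_j|^(d+1)` dominates them by `|z_i|` and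
    -- the top mixed moment.
    have hfac : ∀ r ≤ d + 1, ∫ ω, z ω i * z ω j ^ r ∂P =
        (∫ ω, z ω i ∂P) * ∫ ω, z ω j ^ r ∂P := fun r hr => by
      refine integral_mul_eq_of_condExp_eq_const (hzi j) hX hc (g := fun y => y ^ r)
        (by fun_prop) ((hX.norm.add htop.norm).mono' (by fun_prop) (.of_forall fun ω => ?_))
      have hpow : |z ω j| ^ r ≤ 1 + |z ω j| ^ (d + 1) := by
        rcases le_total |z ω j| 1 with h | h
        · exact (pow_le_one₀ (abs_nonneg _) h).trans (le_add_of_nonneg_right (by positivity))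
        · exact (pow_le_pow_right₀ h hr).trans (le_add_of_nonneg_left zero_le_one)
      simp only [Pi.add_apply, norm_mul, norm_pow, Real.norm_eq_abs]
      calc |z ω i| * |z ω j| ^ r ≤ |z ω i| * (1 + |z ω j| ^ (d + 1)) := by gcongr
        _ = _ := by ring
    rw [momentCumulantTensor_headIndex i j _ fun r hr => hfac r (hr.trans d.le_succ),
      hfac _ le_rfl, sub_self]
  · obtain ⟨d, rfl⟩ := Nat.exists_eq_add_of_le' hd
    obtain ⟨hX, hc⟩ := hmi i j hij
    rw [cgfCumulantTensor_headIndex hz hfin (d + 1) i j, Filter.EventuallyEq.iteratedDeriv_eq (d + 1)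
      (g := fun _ => ∫ ω, z ω i ∂P)]
    · simp [iteratedDeriv_const]
    · filter_upwards [eventually_integrable_exp hfin j,
        eventually_integrable_coord_mul_exp hz hfin i j] with t h1 h2
      rw [div_eq_iff (integral_exp_pos h1).ne']
      exact integral_mul_eq_of_condExp_eq_const (hzi j) hX hc (g := fun y => Real.exp (t * y))
        (by fun_prop) h2
  · have hXI := eventually_integrable_coord_mul_exp hz hfin i j
    have hI := eventually_integrable_exp hfin j
    refine ⟨by simpa using hXI.self_of_nhds,
      condExp_eq_const_of_integral_mul_exp (hzi i) (hzi j) hXI hI ?_⟩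
    set c := ∫ ω, z ω i ∂P
    -- Vanishing of the cumulant of order `d + 2` supplies the power `d + 1`; power `0` is the
    -- definition of `c`.
    have hmom : ∀ r, ∫ ω, z ω i * z ω j ^ r ∂P = c * ∫ ω, z ω j ^ r ∂P := fun r => by
      induction r using Nat.strong_induction_on with
      | _ r ih =>
        rcases r with _ | d
        · simp [c]
        · have := (hV (d + 2) (Nat.le_add_left _ _)).2 i j hij
          rw [momentCumulantTensor_headIndex i j c fun r hr => ih r (Nat.lt_succ_of_le hr)] at this
          exact sub_eq_zero.1 this
    have hI1 : ∀ᶠ t : ℝ in 𝓝 0, Integrable (fun ω => 1 * Real.exp (t * z ω j)) P := by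
      simpa only [one_mul] using hI
    have hA := analyticAt_integral_mul_exp (hzi i) (hzi j) hXI
    have hA1 := analyticAt_integral_mul_exp measurable_const (hzi j) hI1
    have hder := AnalyticAt.eventually_eq_zero_of_iteratedDeriv
      (hA.sub (hA1.const_smul (c := c))) fun k => by
        rw [iteratedDeriv_sub hA.contDiffAt (hA1.const_smul (c := c)).contDiffAt,
          iteratedDeriv_const_smul hA1.contDiffAt,
          iteratedDeriv_integral_mul_exp_zero (hzi i) (hzi j) hXI,
          iteratedDeriv_integral_mul_exp_zero measurable_const (hzi j) hI1, hmom]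
        simp
    filter_upwards [hder] with t ht
    simpa [sub_eq_zero] using ht
  · have hXI := eventually_integrable_coord_mul_exp hz hfin i j
    have hI := eventually_integrable_exp hfin j
    refine ⟨by simpa using hXI.self_of_nhds,
      condExp_eq_const_of_integral_mul_exp (hzi i) (hzi j) hXI hI ?_⟩
    have hI1 : ∀ᶠ t : ℝ in 𝓝 0, Integrable (fun ω => 1 * Real.exp (t * z ω j)) P := by
      simpa only [one_mul] using hI
    have hA := analyticAt_integral_mul_exp (hzi i) (hzi j) hXI
    have hA1 := analyticAt_integral_mul_exp measurable_const (hzi j) hI1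
    simp only [one_mul] at hA1
    -- The denominator equals `1` at `0`. The quotient has value `E z_i` there, and its derivative
    -- of order `k + 1` is a cumulant of order `k + 2`, hence `0`.
    have hquot := hA.div hA1 (by simp)
    have hder := AnalyticAt.eventually_eq_zero_of_iteratedDeriv
      (hquot.sub (analyticAt_const (v := ∫ ω, z ω i ∂P))) fun k => by
        rw [iteratedDeriv_sub hquot.contDiffAt contDiffAt_const]
        rcases k with _ | k
        · simp
        · have := (hV (k + 2) (Nat.le_add_left _ _)).2 i j hij
          rw [cgfCumulantTensor_headIndex hz hfin (k + 1) i j] at this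
          rw [iteratedDeriv_const, if_neg k.succ_ne_zero, sub_zero]
          exact this
    filter_upwards [hder, hI] with t ht ht'
    exact (div_eq_iff (integral_exp_pos ht').ne').1 (sub_eq_zero.1 ht)
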